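/- Let $\Sigma=\{0,1\}$ and let $\mathcal B=(\Sigma^*)^{\Sigma^*}$ be the set of string functions. An oracle Turing machine $M$ is a deterministic multi-tape Turing machine with an input tape, an output tape, an oracle tape, memory tapes and a query state; when, with oracle $\varphi\in\mathcal B$, it is in the query state, then in one step the content $\mathbf b$ of the oracle tape is replaced by $\varphi(\mathbf b)$, without moving a head, and the computation continues. $M$ computes a functional $F:\mathcal B\to\mathcal B$ if for all $\varphi\in\mathcal B$, $\mathbf a\in\Sigma^*$ the computation of $M$ with oracle $\varphi$ on input $\mathbf a$ terminates with output $F(\varphi)(\mathbf a)$. Let $\mathrm{time}_{M^\varphi}(\mathbf a)\in\mathbb N\cup\{\infty\}$ be the number of its steps. Polynomial time. Let $|\varphi|(n)=\max\{|\varphi(\mathbf a)| : |\mathbf a|\le n\}$. The second-order polynomials are the smallest class of functions $\mathbb N^{\mathbb N}\times\mathbb N\to\mathbb N$ that contains $(l,n)\mapsto p(n)$ for every polynomial $p$ with natural coefficients and that is closed under pointwise sum, pointwise product and $P\mapsto\big((l,n)\mapsto l(P(l,n))\big)$. $F$ is polynomial-time computable, $F\in\mathrm P$, if some machine $M$ computing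 $F$ and some second-order polynomial $P$ satisfy $\mathrm{time}_{M^\varphi}(\mathbf a)\le P(|\varphi|,|\mathbf a|)$ for all $\varphi,\mathbf a$. Length revisions. Let $o_{\varphi,\mathbf a}(n)$ be the maximum of $|\mathbf a|$ and the lengths of all oracle answers that $M$ obtains in its first $n$ steps with oracle $\varphi$ on input $\mathbf a$. $M$ has finite length-revision if there is $N\in\mathbb N$ such that for all $\varphi,\mathbf a$ the function $o_{\varphi,\mathbf a}$ takes at most $N$ values; $\mathrm{FLR}$ is the class of functionals computed by such machines. $M$ has a polynomial step-count if there is a polynomial $p$ with natural coefficients such that $n\le p(o_{\varphi,\mathbf a}(n))$ for all $\varphi,\mathbf a$ and all $n\in\mathbb N$ with $n\le\mathrm{time}_{M^\varphi}(\mathbf a)$. $F$ is strongly polynomial-time computable, $F\in\mathrm{SP}$, if it is computed by a machine that has both finite length-revision and a polynomial step-count. **Lemma ($\mathrm{SP}\subsetneq\mathrm P$).** The functional $$F:\mathcal B\to\mathcal B,\qquad F(\varphi)(\mathbf a)=0^{\max\{|\varphi(0^n)|\,:\,n\le|\mathbf a|\}}$$ is polynomial-time computable, but it is not computed by any oracle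 Turing machine with finite length-revision ($F\in\mathrm P\setminus\mathrm{FLR}$). In particular it is not strongly polynomial-time computable, and $\mathrm{SP}$ is a proper subclass of $\mathrm P$. -/

import Mathlib

namespace OracleComplexity

/-- Finite binary strings; `false` is the digit `0` and `true` the digit `1`. -/
abbrev Str : Type := List Bool

/-- String functions: the elements of Baire space. -/
abbrev Baire : Type := Str → Str

/-! ### Oracle Turing machines -/

/-- Tape symbols: the blank, the two binary digits, and further symbols from `A`. -/
inductive Symbol (A : Type) : Type
  | blank : Symbol A
  | bit (b : Bool) : Symbol A
  | extra (x : A) : Symbol A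

instance (A : Type) : Inhabited (Symbol A) := ⟨Symbol.blank⟩

/-- The digit a symbol stands for, if any. -/
def Symbol.toBit? {A : Type} : Symbol A → Option Bool
  | .bit b => some b
  | _ => none

/-- The longest initial block of binary digits in a list of symbols. -/
def bitPrefix {A : Type} : List (Symbol A) → Str
  | [] => []
  | s :: l => match s.toBit? with
    | some b => b :: bitPrefix l
    | none => []

theorem bitPrefix_append_replicate_blank {A : Type} (l : List (Symbol A)) (n : ℕ) :
    bitPrefix (l ++ List.replicate n default) = bitPrefix l := by
  induction l with
  | nil => cases n <;> rfl
  | cons s l ih =>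
    simp only [List.cons_append, bitPrefix]
    rw [ih]

/-- The tapes of a machine: an input tape, an output tape, the oracle query tape, and `k`
memory tapes. -/
inductive TapeIdx (k : ℕ) : Type
  | input : TapeIdx k
  | output : TapeIdx k
  | oracle : TapeIdx k
  | work (i : Fin k) : TapeIdx k

/-- Head movements. -/
inductive Move : Type
  | left : Move
  | stay : Move
  | right : Move

/-- New head position; a head on the leftmost cell `0` that is told to move left stays there. -/
def Move.apply : Move → ℕ → ℕ
  | .left, p => p - 1
  | .stay, p => p
  | .right, p => p + 1

/-- A tape with its head: a one-sided infinite sequence of cells, all but finitely many of which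
are blank, and the position of the head. -/
structure Tape (A : Type) : Type where
  cells : Turing.ListBlank (Symbol A)
  head : ℕ

namespace Tape

variable {A : Type}

/-- The tape with the string `a` written on it from cell `0` onwards and with head position `p`. -/
def ofStr (a : Str) (p : ℕ) : Tape A :=
  ⟨Turing.ListBlank.mk (a.map Symbol.bit), p⟩

/-- The symbol in the cell under the head. -/
def read (t : Tape A) : Symbol A := t.cells.nth t.head

/-- Write a symbol into the cell under the head, then move the head. -/
def act (t : Tape A) (s : Symbol A) (m : Move) : Tape A :=
  ⟨t.cells.modifyNth (fun _ => s) t.head, m.apply t.head⟩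

/-- The string that is written on the tape: the digits from cell `0` up to the first cell that
does not hold a digit. -/
def content (t : Tape A) : Str :=
  t.cells.liftOn bitPrefix (by
    rintro a b ⟨n, rfl⟩
    exact (bitPrefix_append_replicate_blank a n).symm)

end Tape

/-- A (deterministic, multi-tape) oracle Turing machine. -/
structure OracleTM : Type 1 where
  /-- states of the finite control -/
  State : Type
  [decEqState : DecidableEq State]
  [finiteState : Finite State]
  /-- tape symbols besides the blank and the two digits -/
  Extra : Type
  [finiteExtra : Finite Extra]
  /-- number of memory tapes -/
  k : ℕ
  /-- initial state -/
  start : State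
  /-- termination state -/
  halt : State
  /-- oracle query state -/
  query : State
  /-- state in which the computation continues after an oracle query -/
  resume : State
  /-- transition function: the new state and, for each tape, the symbol to be written and the head
  movement, depending on the state and the symbols that are read -/
  δ : State → (TapeIdx k → Symbol Extra) → State × (TapeIdx k → Symbol Extra × Move)

namespace OracleTM

attribute [instance] decEqState finiteState finiteExtra

variable (M : OracleTM)

/-- Configurations of a machine. -/
structure Cfg : Type where
  state : M.State
  tape : TapeIdx M.k → Tape M.Extra

/-- The initial configuration on input `a`: the input tape holds `a`, all other tapes are blank, and
all heads are on cell `0`. -/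
def init (a : Str) : M.Cfg where
  state := M.start
  tape
    | .input => Tape.ofStr a 0
    | _ => Tape.ofStr [] 0

/-- The effect of an oracle query: the content `b` of the oracle tape is replaced by `φ b`, no
head moves, and the computation continues in the state `resume`. -/
def queryStep (φ : Baire) (c : M.Cfg) : M.Cfg where
  state := M.resume
  tape
    | .oracle => Tape.ofStr (φ (c.tape .oracle).content) (c.tape .oracle).head
    | i => c.tape i

/-- An ordinary step, given by the transition function. -/
def plainStep (c : M.Cfg) : M.Cfg :=
  let r := M.δ c.state fun i => (c.tape i).read
  ⟨r.1, fun i => (c.tape i).act (r.2 i).1 (r.2 i).2⟩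

/-- One step of the computation with oracle `φ`; terminated computations do not move on. -/
def step (φ : Baire) (c : M.Cfg) : M.Cfg :=
  if c.state = M.halt then c
  else if c.state = M.query then M.queryStep φ c
  else M.plainStep c

/-- The configuration after `n` steps of the computation with oracle `φ` on input `a`. -/
def run (φ : Baire) (a : Str) : ℕ → M.Cfg
  | 0 => M.init a
  | n + 1 => M.step φ (run φ a n)

/-- The computation with oracle `φ` on input `a` has terminated after `n` steps. -/
def HaltedAt (φ : Baire) (a : Str) (n : ℕ) : Prop :=
  (M.run φ a n).state = M.halt

/-- The number of steps that the computation with oracle `φ` takes on input `a`; it is `⊤` if the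
computation diverges. -/
noncomputable def time (φ : Baire) (a : Str) : ℕ∞ :=
  sInf {t : ℕ∞ | ∃ n : ℕ, t = n ∧ M.HaltedAt φ a n}

/-- `M` computes the total functional `F`: on every oracle `φ` and input `a` the computation
terminates, with `F φ a` on the output tape. -/
def Computes (F : Baire → Baire) : Prop :=
  ∀ φ a, ∃ n, M.HaltedAt φ a n ∧ ((M.run φ a n).tape .output).content = F φ a

/-- The string returned by the oracle in step `n + 1` of the computation (the step that leads from
`run n` to `run (n + 1)`); empty if no query is made in that step. -/
def answer (φ : Baire) (a : Str) (n : ℕ) : Str :=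
  let c := M.run φ a n
  if c.state = M.halt then []
  else if c.state = M.query then φ (c.tape .oracle).content
  else []

/-- The length revision function: the maximum of the length of the input and of the lengths of
all oracle answers obtained in the first `n` steps. -/
def revision (φ : Baire) (a : Str) : ℕ → ℕ
  | 0 => a.length
  | n + 1 => max (revision φ a n) (M.answer φ a n).length

/-- Finite length-revision: the number of values of the length revision functions is bounded
independently of the oracle and of the input. -/
def FiniteLengthRevision : Prop :=
  ∃ N : ℕ, ∀ φ a, (Set.range (M.revision φ a)).encard ≤ N

/-- `t` is a step-count for `M`. -/
def IsStepCount (t : ℕ → ℕ) : Prop :=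
  ∀ φ a (n : ℕ), (n : ℕ∞) ≤ M.time φ a → n ≤ t (M.revision φ a n)

/-- `M` has a polynomial step-count. -/
def HasPolyStepCount : Prop :=
  ∃ p : Polynomial ℕ, M.IsStepCount fun n => p.eval n

end OracleTM

/-! ### Second-order polynomials and classes of functionals -/

/-- The size function `|φ|(n) = max {|φ(a)| : |a| ≤ n}` of a string function. -/
noncomputable def size (φ : Baire) (n : ℕ) : ℕ :=
  (List.finite_length_le Bool n).toFinset.sup fun a => (φ a).length

/-- The class of second-order polynomials. -/
inductive SecondOrderPoly : ((ℕ → ℕ) → ℕ → ℕ) → Prop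
  | poly (p : Polynomial ℕ) : SecondOrderPoly fun _ n => p.eval n
  | add {P Q : (ℕ → ℕ) → ℕ → ℕ} : SecondOrderPoly P → SecondOrderPoly Q →
      SecondOrderPoly fun l n => P l n + Q l n
  | mul {P Q : (ℕ → ℕ) → ℕ → ℕ} : SecondOrderPoly P → SecondOrderPoly Q →
      SecondOrderPoly fun l n => P l n * Q l n
  | app {P : (ℕ → ℕ) → ℕ → ℕ} : SecondOrderPoly P → SecondOrderPoly fun l n => l (P l n)

/-- `T` bounds the running time of `M`. -/
def OracleTM.HasRunningTime (M : OracleTM) (T : (ℕ → ℕ) → ℕ → ℕ) : Prop :=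
  ∀ φ a, M.time φ a ≤ (T (size φ) a.length : ℕ)

/-- The class `P` of polynomial-time computable functionals. -/
def PolyTime : Set (Baire → Baire) :=
  {F | ∃ M : OracleTM, M.Computes F ∧ ∃ P, SecondOrderPoly P ∧ M.HasRunningTime P}

/-- The class `FLR` of functionals computable with finite length-revision. -/
def FLR : Set (Baire → Baire) :=
  {F | ∃ M : OracleTM, M.Computes F ∧ M.FiniteLengthRevision}

/-- The class `SP` of strongly polynomial-time computable functionals. -/
def StrongPolyTime : Set (Baire → Baire) :=
  {F | ∃ M : OracleTM, M.Computes F ∧ M.FiniteLengthRevision ∧ M.HasPolyStepCount}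

/-- The functional `F(φ)(a) = 0 ^ max {|φ(0 ^ n)| : n ≤ |a|}`. -/
def maxLength (φ : Baire) (a : Str) : Str :=
  List.replicate
    ((Finset.range (a.length + 1)).sup fun n => (φ (List.replicate n false)).length) false

end OracleComplexity

/-! Non-membership in FLR is an adversary argument. A machine for `maxLength` must query every `0 ^
m` with `m ≤ |a|`: an unasked value could be made longer than the output without changing the
computation (`Computes.exists_queriesAt`). The adversary answers each of these `|a| + 1` queries,
when it first occurs, by a string longer than everything seen so far. Each such answer is a new
length revision, so the number of revisions grows with `|a|` (`Computes.exists_revisions`).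

For SP ⊆ P, let `o` be the current revised length. At most `p(o)` steps have been made, so a query
has length at most `o + p(o)` and its answer at most `|φ|(o + p(o))`. Boundedly many iterations of
this estimate give a second-order polynomial bound on all revised lengths, and `p` of that bounds
the time (`revision_le_iteratedRevision`).

Membership in P needs an explicit machine. It asks `0 ^ 0, ..., 0 ^ |a|` in turn and keeps the
maximal answer length in unary on the output tape. Each round is linear in `|a| + |φ|(|a|)`
(`exists_describes_halt`). -/

namespace OracleComplexity

/-! ### Runs, termination and dependence on the oracle. -/

namespace OracleTM

variable (M : OracleTM)

/-- In step `n + 1` of the computation the oracle is queried on the string `b`. -/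
def QueriesAt (φ : Baire) (a : Str) (n : ℕ) (b : Str) : Prop :=
  (M.run φ a n).state ≠ M.halt ∧ (M.run φ a n).state = M.query ∧
    ((M.run φ a n).tape .oracle).content = b

variable {M}

theorem answer_of_queriesAt {φ : Baire} {a b : Str} {n : ℕ} (h : M.QueriesAt φ a n b) :
    M.answer φ a n = φ b := by
  obtain ⟨h₁, h₂, rfl⟩ := h
  simp only [answer]
  rw [if_neg h₁, if_pos h₂]

theorem answer_eq_nil_or (φ : Baire) (a : Str) (n : ℕ) :
    M.answer φ a n = [] ∨ ∃ b, M.QueriesAt φ a n b := by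
  by_cases h₁ : (M.run φ a n).state = M.halt
  · left; simp [answer, h₁]
  by_cases h₂ : (M.run φ a n).state = M.query
  · exact .inr ⟨_, h₁, h₂, rfl⟩
  · left; simp [answer, h₁, h₂]

theorem revision_mono (φ : Baire) (a : Str) : Monotone (M.revision φ a) :=
  monotone_nat_of_le_succ fun _ => le_max_left _ _

theorem run_of_haltedAt {φ : Baire} {a : Str} {n m : ℕ} (h : M.HaltedAt φ a n) (hnm : n ≤ m) :
    M.run φ a m = M.run φ a n := by
  induction m, hnm using Nat.le_induction with
  | base => rfl
  | succ m _ ih =>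
    simp only [HaltedAt] at h
    simp [run, step, ih, h]

theorem time_le_of_haltedAt {φ : Baire} {a : Str} {n : ℕ} (h : M.HaltedAt φ a n) :
    M.time φ a ≤ n :=
  sInf_le ⟨n, rfl, h⟩

theorem le_time_of_not_haltedAt {φ : Baire} {a : Str} {n : ℕ} (h : ¬ M.HaltedAt φ a n) :
    ((n + 1 : ℕ) : ℕ∞) ≤ M.time φ a := by
  refine le_sInf ?_
  rintro t ⟨m, rfl, hm⟩
  norm_cast
  by_contra hlt
  apply h
  have := run_of_haltedAt hm (show m ≤ n by omega)
  simpa [HaltedAt, this] using hm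

theorem Computes.time_ne_top {F : Baire → Baire} (h : M.Computes F) (φ : Baire) (a : Str) :
    M.time φ a ≠ ⊤ := by
  obtain ⟨n, hn, -⟩ := h φ a
  exact ((time_le_of_haltedAt hn).trans_lt (ENat.natCast_lt_top n)).ne

/-- A computation depends on the oracle only through the answers it obtains. -/
theorem run_eq_of_agree {φ ψ : Baire} {a : Str} {n : ℕ}
    (h : ∀ m < n, ∀ b, M.QueriesAt φ a m b → ψ b = φ b) : M.run ψ a n = M.run φ a n := by
  induction n with
  | zero => rfl
  | succ n ih =>
    have ih := ih fun m hm => h m (by omega)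
    simp only [run, step, ih]
    split_ifs with h₁ h₂
    · rfl
    · simp only [queryStep]
      rw [h n (by omega) _ ⟨h₁, h₂, rfl⟩]
    · rfl

/-- Agreement strictly before `n` suffices: the query string is fixed before its answer arrives. The
adversary may therefore still choose that answer. -/
theorem queriesAt_iff_of_agree {φ ψ : Baire} {a : Str} {n : ℕ}
    (h : ∀ m < n, ∀ b, M.QueriesAt φ a m b → ψ b = φ b) {b : Str} :
    M.QueriesAt ψ a n b ↔ M.QueriesAt φ a n b := by
  simp only [QueriesAt, run_eq_of_agree h]

theorem revision_eq_of_agree {φ ψ : Baire} {a : Str} {n : ℕ}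
    (h : ∀ m < n, ∀ b, M.QueriesAt φ a m b → ψ b = φ b) :
    M.revision ψ a n = M.revision φ a n := by
  induction n with
  | zero => rfl
  | succ n ih =>
    have h' : ∀ m < n, ∀ b, M.QueriesAt φ a m b → ψ b = φ b := fun m hm => h m (by omega)
    have : M.answer ψ a n = M.answer φ a n := by
      simp only [answer, run_eq_of_agree h']
      split_ifs with h₁ h₂
      · rfl
      · exact h n (by omega) _ ⟨h₁, h₂, rfl⟩
      · rfl
    simp only [revision, ih h', this]

/-! ### Every machine for `maxLength` revises lengths unboundedly often -/

theorem Computes.eq_of_run_eq {F : Baire → Baire} (hM : M.Computes F) {φ ψ : Baire} {a : Str}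
    (h : ∀ n, M.run ψ a n = M.run φ a n) : F ψ a = F φ a := by
  obtain ⟨n, hn, hn'⟩ := hM φ a
  obtain ⟨m, hm, hm'⟩ := hM ψ a
  rw [← hn', ← hm', ← run_of_haltedAt hn (le_max_left n m),
    ← run_of_haltedAt hm (le_max_right n m), h]

theorem length_le_length_maxLength (φ : Baire) {a : Str} {m : ℕ} (hm : m ≤ a.length) :
    (φ (List.replicate m false)).length ≤ (maxLength φ a).length := by
  rw [maxLength, List.length_replicate]
  exact Finset.le_sup (f := fun n => (φ (List.replicate n false)).length)
    (Finset.mem_range.2 (by omega))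

/-- Otherwise the value at `0 ^ m` could be replaced by a string one longer than the output. The run
would stay the same, yet the correct output would have to be longer. -/
theorem Computes.exists_queriesAt (hM : M.Computes maxLength) (φ : Baire) {a : Str} {m : ℕ}
    (hm : m ≤ a.length) : ∃ n, M.QueriesAt φ a n (List.replicate m false) := by
  classical
  by_contra! hno
  set z := List.replicate m false
  set ψ : Baire := Function.update φ z (List.replicate ((maxLength φ a).length + 1) false) with hψ
  have heq : maxLength ψ a = maxLength φ a := by
    refine hM.eq_of_run_eq fun n => run_eq_of_agree fun i _ b hb => ?_
    have : b ≠ z := by rintro rfl; exact hno i hb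
    simp [hψ, this]
  have := length_le_length_maxLength ψ hm
  rw [heq] at this
  simp [hψ, z] at this

/-- The adversary's strategy by induction on the number `i` of forced revisions. `S` contains every
`m ≤ |a|` for which `0 ^ m` was asked before time `t`; any other `m` can still have its value
changed without affecting the first `t` steps. -/
theorem Computes.exists_revisions (hM : M.Computes maxLength) (a : Str) (i : ℕ)
    (hi : i ≤ a.length + 1) :
    ∃ (φ : Baire) (t : ℕ) (S : Finset ℕ), S.card ≤ i ∧
      (∀ n < t, ∀ m ≤ a.length, M.QueriesAt φ a n (List.replicate m false) → m ∈ S) ∧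
      i + 1 ≤ ((Finset.range (t + 1)).image (M.revision φ a)).card := by
  classical
  induction i with
  | zero => exact ⟨fun _ => [], 0, ∅, by simp, by simp, by simp⟩
  | succ i ih =>
    obtain ⟨φ, t, S, hS, hq, hc⟩ := ih (by omega)
    -- `S` has at most `i ≤ |a|` elements, so one of the `|a| + 1` mandatory queries is still fresh.
    obtain ⟨m₀, hm₀, hm₀S⟩ : ∃ m ∈ Finset.range (a.length + 1), m ∉ S :=
      Finset.exists_mem_notMem_of_card_lt_card (by simp; omega)
    have hex : ∃ n, ∃ m ≤ a.length, m ∉ S ∧ M.QueriesAt φ a n (List.replicate m false) := by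
      have hm : m₀ ≤ a.length := by simpa [Nat.lt_succ_iff] using hm₀
      obtain ⟨n, hn⟩ := hM.exists_queriesAt φ hm
      exact ⟨n, m₀, hm, hm₀S, hn⟩
    -- Take the first time `s` at which any fresh `0 ^ m` is asked; this `m` may differ from `m₀`.
    -- By minimality, changing the value at `0 ^ m` leaves the first `s` steps intact.
    obtain ⟨m, hm, hmS, hms⟩ := Nat.find_spec hex
    have hmin := fun n (hn : n < Nat.find hex) => Nat.find_min hex hn
    generalize Nat.find hex = s at hms hmin
    have hts : t ≤ s := by
      by_contra! hlt
      exact hmS (hq s hlt m hm hms)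
    set ψ : Baire := Function.update φ (List.replicate m false)
      (List.replicate (M.revision φ a s + 1) false) with hψ
    have hagree : ∀ n < s, ∀ b, M.QueriesAt φ a n b → ψ b = φ b := by
      intro n hn b hb
      have : b ≠ List.replicate m false := by
        rintro rfl
        exact hmin n hn ⟨m, hm, hmS, hb⟩
      simp [hψ, this]
    have hagree' : ∀ n ≤ s, ∀ k < n, ∀ b, M.QueriesAt φ a k b → ψ b = φ b :=
      fun n hn k hk => hagree k (by omega)
    refine ⟨ψ, s + 1, insert m S, (Finset.card_insert_le _ _).trans (by omega), ?_, ?_⟩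
    · intro n hn k hk hb
      rw [queriesAt_iff_of_agree (hagree' n (by omega))] at hb
      rw [Finset.mem_insert]
      by_contra! hne
      rcases Nat.lt_succ_iff_lt_or_eq.1 hn with h | rfl
      · exact hmin n h ⟨k, hk, hne.2, hb⟩
      -- Only one string is asked in a given step, so `0 ^ k = 0 ^ m`.
      · refine hne.1 ?_
        simpa using congrArg List.length (hb.2.2.symm.trans hms.2.2)
    · have hnew : M.revision φ a s < M.revision ψ a (s + 1) := by
        have hans := answer_of_queriesAt ((queriesAt_iff_of_agree hagree).2 hms)
        simp only [revision, hans]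
        simp [hψ]
      have hsub : insert (M.revision ψ a (s + 1))
          ((Finset.range (t + 1)).image (M.revision φ a)) ⊆
          (Finset.range (s + 1 + 1)).image (M.revision ψ a) := by
        intro x hx
        simp only [Finset.mem_insert, Finset.mem_image, Finset.mem_range] at hx ⊢
        rcases hx with rfl | ⟨n, hn, rfl⟩
        · exact ⟨s + 1, by omega, rfl⟩
        · exact ⟨n, by omega, revision_eq_of_agree (hagree' n (by omega))⟩
      refine le_trans ?_ (Finset.card_le_card hsub)
      rw [Finset.card_insert_of_notMem]
      · omega
      · simp only [Finset.mem_image, Finset.mem_range, not_exists, not_and]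
        intro n hn heq
        have := M.revision_mono φ a (show n ≤ s by omega)
        omega

end OracleTM

theorem maxLength_notMem_FLR : maxLength ∉ FLR := by
  rintro ⟨M, hM, N, hN⟩
  -- An input of length `N` allows `i = N + 1`, hence `N + 2` values, more than the `N` permitted.
  obtain ⟨φ, t, -, -, -, hc⟩ :=
    hM.exists_revisions (List.replicate N false) (N + 1) (by simp)
  have h := hN φ (List.replicate N false)
  have hsub : (((Finset.range (t + 1)).image (M.revision φ (List.replicate N false)) :
      Finset ℕ) : Set ℕ) ⊆ Set.range (M.revision φ (List.replicate N false)) := by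
    intro x hx
    obtain ⟨n, -, rfl⟩ := Finset.mem_image.1 (Finset.mem_coe.1 hx)
    exact ⟨n, rfl⟩
  have h' := (Set.encard_le_encard hsub).trans h
  rw [Set.encard_coe_eq_coe_finsetCard] at h'
  norm_cast at h'
  omega

/-! ### Tape contents read off cell by cell. -/

theorem bitPrefix_eq_of_getI {A : Type} {l : List (Symbol A)} {s : Str}
    (h : ∀ i (hi : i < s.length), l.getI i = .bit s[i])
    (hend : (l.getI s.length).toBit? = none) : bitPrefix l = s := by
  induction s generalizing l with
  | nil =>
    cases l with
    | nil => rfl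
    | cons x l => simp_all [bitPrefix]
  | cons b s ih =>
    have h0 := h 0 (by simp)
    cases l with
    | nil => exact absurd h0 (by simp [default])
    | cons x l =>
      obtain rfl : x = .bit b := by simpa using h0
      simp only [bitPrefix, Symbol.toBit?]
      rw [ih (fun i hi => ?_) (by simpa using hend)]
      have := h (i + 1) (by simpa using hi)
      rwa [List.getI_cons_succ, List.getElem_cons_succ] at this

theorem length_bitPrefix_le {A : Type} {l : List (Symbol A)} {n : ℕ}
    (h : l.getI n = .blank) : (bitPrefix l).length ≤ n := by
  induction l generalizing n with
  | nil => simp [bitPrefix]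
  | cons x l ih =>
    cases n with
    | zero =>
      obtain rfl : x = .blank := by simpa using h
      simp [bitPrefix, Symbol.toBit?]
    | succ n =>
      have := ih (n := n) (by simpa using h)
      cases x <;> simp [bitPrefix, Symbol.toBit?, this]

namespace Tape

variable {A : Type}

theorem content_eq_of_nth {t : Tape A} {s : Str}
    (h : ∀ i (hi : i < s.length), t.cells.nth i = .bit s[i])
    (hend : (t.cells.nth s.length).toBit? = none) : t.content = s := by
  obtain ⟨c, p⟩ := t
  induction c using Turing.ListBlank.induction_on with
  | h l => exact bitPrefix_eq_of_getI h hend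

theorem length_content_le {t : Tape A} {n : ℕ} (h : t.cells.nth n = .blank) :
    t.content.length ≤ n := by
  obtain ⟨c, p⟩ := t
  induction c using Turing.ListBlank.induction_on with
  | h l => exact length_bitPrefix_le h

theorem nth_ofStr (a : Str) (p i : ℕ) :
    (ofStr a p : Tape A).cells.nth i = (a[i]?.map Symbol.bit).getD .blank := by
  simp only [ofStr, Turing.ListBlank.nth_mk, List.getI_eq_getElem?_getD, List.getElem?_map]
  rfl

theorem nth_ofStr_of_length_le {a : Str} (p : ℕ) {i : ℕ} (h : a.length ≤ i) :
    (ofStr a p : Tape A).cells.nth i = .blank := by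
  simp [nth_ofStr, h]

theorem nth_act (t : Tape A) (s : Symbol A) (m : Move) (i : ℕ) :
    (t.act s m).cells.nth i = if i = t.head then s else t.cells.nth i := by
  simp [act, Turing.ListBlank.nth_modifyNth]

theorem _root_.OracleComplexity.Move.apply_le (m : Move) (p : ℕ) : m.apply p ≤ p + 1 := by
  cases m <;> simp only [Move.apply] <;> omega

end Tape

/-! ### Strongly polynomial time is contained in polynomial time. -/

theorem length_le_size (φ : Baire) {b : Str} {n : ℕ} (h : b.length ≤ n) :
    (φ b).length ≤ size φ n :=
  Finset.le_sup (f := fun a => (φ a).length) (by simpa using h)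

theorem size_mono (φ : Baire) : Monotone (size φ) := by
  intro m n h
  refine Finset.sup_le fun b hb => length_le_size φ ?_
  have : b.length ≤ m := by simpa using hb
  exact this.trans h

namespace OracleTM

variable {M : OracleTM}

theorem length_answer_le_revision (φ : Baire) (a : Str) (n : ℕ) :
    (M.answer φ a n).length ≤ M.revision φ a (n + 1) :=
  le_max_right _ _

/-- The oracle head has not moved far, and neither written symbols nor oracle answers reach far. -/
theorem oracle_tape_bound (φ : Baire) (a : Str) (n : ℕ) :
    ((M.run φ a n).tape .oracle).head ≤ n ∧
      ∀ i, max (M.revision φ a n) n ≤ i →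
        ((M.run φ a n).tape .oracle).cells.nth i = .blank := by
  induction n with
  | zero => exact ⟨le_rfl, fun i _ => Tape.nth_ofStr_of_length_le 0 (Nat.zero_le i)⟩
  | succ n ih =>
    obtain ⟨hh, hc⟩ := ih
    have hrev := M.revision_mono φ a (Nat.le_add_right n 1)
    have hans := M.length_answer_le_revision φ a n
    simp only [run, step]
    split_ifs with h₁ h₂
    · exact ⟨by omega, fun i hi => hc i (by omega)⟩
    · refine ⟨by simp only [queryStep, Tape.ofStr]; omega, fun i hi => ?_⟩
      have := answer_of_queriesAt (M := M) (φ := φ) (a := a) (n := n) ⟨h₁, h₂, rfl⟩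
      rw [this] at hans
      exact Tape.nth_ofStr_of_length_le _ (by omega)
    · refine ⟨(Move.apply_le _ _).trans (by omega), fun i hi => ?_⟩
      simp only [plainStep, Tape.nth_act]
      rw [if_neg (by omega), hc i (by omega)]

theorem length_answer_le (φ : Baire) (a : Str) (n : ℕ) :
    (M.answer φ a n).length ≤ size φ (M.revision φ a n + n) := by
  rcases M.answer_eq_nil_or φ a n with h | ⟨b, hb⟩
  · simp [h]
  · rw [answer_of_queriesAt hb]
    refine length_le_size φ ?_
    rw [← hb.2.2]
    refine (Tape.length_content_le ((M.oracle_tape_bound φ a n).2 _ le_rfl)).trans ?_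
    omega

end OracleTM

theorem SecondOrderPoly.eval_comp {P : (ℕ → ℕ) → ℕ → ℕ} (hP : SecondOrderPoly P)
    (p : Polynomial ℕ) : SecondOrderPoly fun l n => p.eval (P l n) := by
  induction p using Polynomial.induction_on with
  | C c => simpa using SecondOrderPoly.poly (Polynomial.C c)
  | add p q hp hq => simpa using hp.add hq
  | monomial n c ih =>
    have := ih.mul hP
    convert this using 3
    simp [pow_succ, mul_assoc]

/-- A bound for the revised length after `i` revisions of a computation with step-count `p`. -/
def iteratedRevision (p : Polynomial ℕ) : ℕ → (ℕ → ℕ) → ℕ → ℕ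
  | 0 => fun _ n => n
  | i + 1 => fun l n => iteratedRevision p i l n +
      l (iteratedRevision p i l n + p.eval (iteratedRevision p i l n))

theorem secondOrderPoly_iteratedRevision (p : Polynomial ℕ) (i : ℕ) :
    SecondOrderPoly (iteratedRevision p i) := by
  induction i with
  | zero =>
    have : iteratedRevision p 0 = fun _ n => Polynomial.X.eval n := by
      simp only [Polynomial.eval_X]
      rfl
    exact this ▸ SecondOrderPoly.poly Polynomial.X
  | succ i ih => exact ih.add (ih.add (ih.eval_comp p)).app

theorem iteratedRevision_mono (p : Polynomial ℕ) (l : ℕ → ℕ) (n : ℕ) :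
    Monotone fun i => iteratedRevision p i l n :=
  monotone_nat_of_le_succ fun _ => Nat.le_add_right _ _

theorem eval_mono (p : Polynomial ℕ) : Monotone fun n => p.eval n := by
  intro m n h
  simp only [Polynomial.eval_eq_sum_range]
  gcongr

/-- The index `i` grows only at steps where the revised length strictly increases. It is thus tied
to the number of values taken, which finite length-revision bounds uniformly. -/
theorem OracleTM.revision_le_iteratedRevision {M : OracleTM} {p : Polynomial ℕ}
    (hp : M.IsStepCount fun n => p.eval n) (φ : Baire) (a : Str) (n : ℕ) :
    ∃ i, M.revision φ a n ≤ iteratedRevision p i (size φ) a.length ∧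
      i + 1 ≤ ((Finset.range (n + 1)).image (M.revision φ a)).card := by
  classical
  induction n with
  | zero => exact ⟨0, le_rfl, by simp⟩
  | succ n ih =>
    obtain ⟨i, hi, hc⟩ := ih
    rcases (M.revision_mono φ a (Nat.le_add_right n 1)).eq_or_lt with heq | hlt
    · refine ⟨i, heq ▸ hi, hc.trans (Finset.card_le_card (Finset.image_subset_image ?_))⟩
      exact Finset.range_mono (by omega)
    · refine ⟨i + 1, ?_, ?_⟩
      -- A terminated computation obtains no answers, so a revision after `n` steps places `n`
      -- within the running time, where the step-count applies.
      · have hhalt : ¬ M.HaltedAt φ a n := by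
          intro h
          simp only [HaltedAt] at h
          simp [revision, answer, h] at hlt
        have hn : n ≤ p.eval (M.revision φ a n) :=
          hp φ a n (le_trans (by norm_cast; omega) (le_time_of_not_haltedAt hhalt))
        have hn' := hn.trans (eval_mono p hi)
        refine max_le (hi.trans (Nat.le_add_right _ _)) ?_
        refine (M.length_answer_le φ a n).trans ?_
        refine (size_mono φ ?_).trans (Nat.le_add_left _ _)
        exact add_le_add hi hn'
      · rw [Finset.range_add_one, Finset.image_insert, Finset.card_insert_of_notMem]
        · omega
        · simp only [Finset.mem_image, Finset.mem_range, not_exists, not_and]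
          intro m hm heq
          have := M.revision_mono φ a (show m ≤ n by omega)
          omega

theorem strongPolyTime_subset_polyTime : StrongPolyTime ⊆ PolyTime := by
  classical
  rintro F ⟨M, hM, ⟨N, hN⟩, p, hp⟩
  refine ⟨M, hM, _, (secondOrderPoly_iteratedRevision p N).eval_comp p, fun φ a => ?_⟩
  -- The step-count is applied at the running time `T` itself, which is finite because `M` computes
  -- a total functional.
  obtain ⟨T, hT⟩ := ENat.ne_top_iff_exists.1 (hM.time_ne_top φ a)
  obtain ⟨i, hi, hc⟩ := M.revision_le_iteratedRevision hp φ a T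
  have hiN : i ≤ N := by
    have hsub : (((Finset.range (T + 1)).image (M.revision φ a) : Finset ℕ) : Set ℕ) ⊆
        Set.range (M.revision φ a) := by
      intro x hx
      obtain ⟨n, -, rfl⟩ := Finset.mem_image.1 (Finset.mem_coe.1 hx)
      exact ⟨n, rfl⟩
    have h := (Set.encard_le_encard hsub).trans (hN φ a)
    rw [Set.encard_coe_eq_coe_finsetCard] at h
    norm_cast at h
    omega
  rw [← hT]
  norm_cast
  exact (hp φ a T hT.le).trans (eval_mono p (hi.trans (iteratedRevision_mono p _ _ hiN)))

theorem strongPolyTime_subset_FLR : StrongPolyTime ⊆ FLR :=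
  fun _ ⟨M, hM, hN, _⟩ => ⟨M, hM, hN⟩

/-! ### A polynomial-time machine for `maxLength`. -/

namespace MaxLengthMachine

/-- Control states of a machine for `maxLength`. -/
inductive Control : Type
  | start | query | resume | scan | fill | halt
  deriving DecidableEq

instance : Fintype Control :=
  ⟨{.start, .query, .resume, .scan, .fill, .halt}, fun s => by cases s <;> simp⟩

/-- The additional tape symbol. It marks cell `0` of the memory tape, and those cells of the input
tape that have been counted. -/
abbrev mark : Symbol Unit := .extra ()

/-- Does the symbol differ from the digits and the blank? -/
def isMark : Symbol Unit → Bool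
  | .extra _ => true
  | _ => false

/-- Is the symbol a digit? -/
def isBit (s : Symbol Unit) : Bool := s.toBit?.isSome

/-- Symbols for the four tapes, written while all heads make the same move. -/
def acts (i o q w : Symbol Unit) (m : Move) : TapeIdx 1 → Symbol Unit × Move
  | .input => (i, m)
  | .output => (o, m)
  | .oracle => (q, m)
  | .work _ => (w, m)

/-- The symbol to be written on the output tape while an oracle answer is scanned. -/
def copy (q o : Symbol Unit) : Symbol Unit :=
  if isBit q then .bit false else o

/-- The symbol to be written on the oracle tape while a query is prepared. -/
def unary (i : Symbol Unit) : Symbol Unit :=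
  if isMark i then .bit false else .blank

/-- The transition function, given the symbols on the four tapes. All heads move together. After a
query the heads scan the answer and the input from left to right, extending the output to the length
of the answer and marking one more cell of the input; then, from right to left, the next query is
written below the marked cells. If there was no cell left to be marked, the machine terminates. -/
def trans (i o q w : Symbol Unit) : Control → Control × (TapeIdx 1 → Symbol Unit × Move)
  | .start => (.query, acts i o q mark .stay)
  | .resume =>
    if isBit i then (.scan, acts mark (copy q o) q w .right)
    else if isMark i || isBit q then (.resume, acts i (copy q o) q w .right)
    else (.halt, acts i o q w .stay)
  | .scan =>
    if isBit i || isMark i || isBit q then (.scan, acts i (copy q o) q w .right)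
    else (.fill, acts i o q w .stay)
  | .fill =>
    if isMark w then (.query, acts i o (unary i) w .stay)
    else (.fill, acts i o (unary i) w .left)
  | s => (s, acts i o q w .stay)

/-- A machine that computes `maxLength`. -/
abbrev machine : OracleTM where
  State := Control
  Extra := Unit
  k := 1
  start := .start
  halt := .halt
  query := .query
  resume := .resume
  δ s r := trans (r .input) (r .output) (r .oracle) (r (.work 0)) s

/-- The cells of a tape that holds the string `b`. -/
def strCells (b : Str) (j : ℕ) : Symbol Unit := (b[j]?.map Symbol.bit).getD .blank

/-- The cells of the input tape after `n` cells have been marked. -/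
def inCells (a : Str) (n j : ℕ) : Symbol Unit := if j < n then mark else strCells a j

/-- The cells of a tape that holds a block of `m` zeros. -/
def zeroCells (m j : ℕ) : Symbol Unit := if j < m then .bit false else .blank

/-- The cells of the memory tape. -/
def workCells (j : ℕ) : Symbol Unit := if j = 0 then mark else .blank

@[simp]
theorem isBit_strCells (b : Str) (j : ℕ) : isBit (strCells b j) = decide (j < b.length) := by
  by_cases h : j < b.length
  · simp [strCells, isBit, Symbol.toBit?, h]
  · simp [strCells, isBit, Symbol.toBit?, h]

@[simp]
theorem isMark_strCells (b : Str) (j : ℕ) : isMark (strCells b j) = false := by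
  by_cases h : j < b.length
  · simp [strCells, isMark, h]
  · simp [strCells, isMark, not_lt.1 h]

@[simp]
theorem isBit_inCells (a : Str) (n j : ℕ) :
    isBit (inCells a n j) = decide (n ≤ j ∧ j < a.length) := by
  unfold inCells
  split_ifs with h
  · simp [isBit, Symbol.toBit?, h]
  · simp [not_lt.1 h]

@[simp]
theorem isMark_inCells (a : Str) (n j : ℕ) : isMark (inCells a n j) = decide (j < n) := by
  unfold inCells
  split_ifs with h
  · simp [h, isMark]
  · simp [h]

@[simp]
theorem isMark_workCells (j : ℕ) : isMark (workCells j) = decide (j = 0) := by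
  unfold workCells
  split_ifs with h <;> simp [h, isMark]

theorem unary_inCells (a : Str) (n j : ℕ) : unary (inCells a n j) = zeroCells n j := by
  simp [unary, zeroCells]

theorem strCells_of_length_le {b : Str} {j : ℕ} (h : b.length ≤ j) : strCells b j = .blank := by
  simp [strCells, h]

/-- Loop invariant for the scan: with the head on `p`, the output block has length `max m (min p
|b|)`. Writing a zero at `p < |b|` either overwrites a zero, if `p < m`, or extends the block by
exactly its next cell. -/
theorem zeroCells_scan (b : Str) (m p j : ℕ) :
    zeroCells (max m (min (p + 1) b.length)) j =
      if j = p then copy (strCells b p) (zeroCells (max m (min p b.length)) p)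
      else zeroCells (max m (min p b.length)) j := by
  simp only [copy, isBit_strCells, zeroCells, decide_eq_true_eq]
  split_ifs <;> first | rfl | omega

/-- A description of a configuration of `machine` in which all heads are on cell `p`. -/
structure Describes (s : Control) (p : ℕ) (I O Q : ℕ → Symbol Unit) (c : machine.Cfg) : Prop where
  state : c.state = s
  head : ∀ i, (c.tape i).head = p
  input : ∀ j, (c.tape .input).cells.nth j = I j
  output : ∀ j, (c.tape .output).cells.nth j = O j
  oracle : ∀ j, (c.tape .oracle).cells.nth j = Q j
  work : ∀ j, (c.tape (.work (0 : Fin 1))).cells.nth j = workCells j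

variable {φ : Baire} {c : machine.Cfg} {p : ℕ} {I O Q I' O' Q' : ℕ → Symbol Unit}

theorem Describes.plain {s s' : Control} {i o q : Symbol Unit} {m : Move}
    (h : Describes s p I O Q c) (hs : s ≠ .halt) (hs' : s ≠ .query)
    (ht : trans (I p) (O p) (Q p) (workCells p) s = (s', acts i o q (workCells p) m))
    (hI : ∀ j, I' j = if j = p then i else I j)
    (hO : ∀ j, O' j = if j = p then o else O j)
    (hQ : ∀ j, Q' j = if j = p then q else Q j) :
    Describes s' (m.apply p) I' O' Q' (machine.step φ c) := by
  have hstep : machine.step φ c =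
      ⟨s', fun i' => (c.tape i').act (acts i o q (workCells p) m i').1
        (acts i o q (workCells p) m i').2⟩ := by
    have hr : machine.δ c.state (fun i => (c.tape i).read) =
        (s', acts i o q (workCells p) m) := by
      simp only [Tape.read, h.head, h.input, h.output, h.oracle, h.work, h.state]
      exact ht
    rw [OracleTM.step, if_neg (by rw [h.state]; exact hs), if_neg (by rw [h.state]; exact hs'),
      OracleTM.plainStep, hr]
  rw [hstep]
  refine ⟨rfl, fun i' => ?_, fun j => ?_, fun j => ?_, fun j => ?_, fun j => ?_⟩
  · change Move.apply _ (c.tape i').head = _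
    rw [h.head]
    cases i' <;> rfl
  · simp only [Tape.nth_act, h.head, h.input, hI, acts]
  · simp only [Tape.nth_act, h.head, h.output, hO, acts]
  · simp only [Tape.nth_act, h.head, h.oracle, hQ, acts]
  · simp only [Tape.nth_act, h.head, h.work, acts]
    split_ifs with hj <;> simp [hj]

theorem Describes.ask {n : ℕ} (h : Describes .query p I O (zeroCells n) c) :
    Describes .resume p I O (strCells (φ (List.replicate n false))) (machine.step φ c) := by
  have hb : (c.tape .oracle).content = List.replicate n false := by
    refine Tape.content_eq_of_nth (fun i hi => ?_) ?_
    · rw [h.oracle]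
      simpa [zeroCells] using hi
    · rw [h.oracle]
      simp [zeroCells, Symbol.toBit?]
  have hstep : machine.step φ c = machine.queryStep φ c := by
    rw [OracleTM.step, if_neg (by rw [h.state]; exact Control.noConfusion),
      if_pos h.state]
  rw [hstep]
  refine ⟨rfl, fun i => ?_, h.input, h.output, fun j => ?_, h.work⟩
  · cases i
    case oracle => exact h.head .oracle
    all_goals exact h.head _
  · rw [← hb]
    exact Tape.nth_ofStr _ _ j

variable {a b : Str} {m n : ℕ}

/-- The head passes over input cells marked in earlier rounds, or, once the input is exhausted, over
the rest of the answer. The latter is needed in the last round only. -/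
theorem Describes.resume_skip
    (h : Describes .resume p (inCells a n) (zeroCells (max m (min p b.length))) (strCells b) c)
    (hp : p < n ∨ a.length ≤ p ∧ p < b.length) :
    Describes .resume (p + 1) (inCells a n) (zeroCells (max m (min (p + 1) b.length)))
      (strCells b) (machine.step φ c) := by
  refine h.plain (m := .right) (by simp) (by simp) ?_ (fun j => ?_) (zeroCells_scan b m p)
    (fun j => ?_) (i := inCells a n p) (q := strCells b p)
  · simp only [trans]
    rw [if_neg (by simp; omega), if_pos (by simp; omega)]
  all_goals split_ifs with hj <;> simp [hj]

theorem Describes.resume_mark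
    (h : Describes .resume n (inCells a n) (zeroCells (max m (min n b.length))) (strCells b) c)
    (hn : n < a.length) :
    Describes .scan (n + 1) (inCells a (n + 1)) (zeroCells (max m (min (n + 1) b.length)))
      (strCells b) (machine.step φ c) := by
  refine h.plain (m := .right) (by simp) (by simp) ?_ (fun j => ?_) (zeroCells_scan b m n)
    (fun j => ?_) (i := mark) (q := strCells b n)
  · simp only [trans]
    rw [if_pos (by simp; omega)]
  · simp only [inCells]
    split_ifs <;> first | rfl | omega
  · split_ifs with hj <;> simp [hj]

theorem Describes.resume_halt
    (h : Describes .resume p (inCells a a.length) O (strCells b) c)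
    (hp : p = max a.length b.length) :
    Describes .halt p (inCells a a.length) O (strCells b) (machine.step φ c) := by
  refine h.plain (m := .stay) (by simp) (by simp) ?_ (fun j => ?_) (fun j => ?_) (fun j => ?_)
    (i := inCells a a.length p) (o := O p) (q := strCells b p)
  · simp only [trans]
    rw [if_neg (by simp), if_neg (by simp; omega)]
  all_goals split_ifs with hj <;> simp [hj]

theorem Describes.scan_skip
    (h : Describes .scan p (inCells a n) (zeroCells (max m (min p b.length))) (strCells b) c)
    (hp : p < max a.length b.length) :
    Describes .scan (p + 1) (inCells a n) (zeroCells (max m (min (p + 1) b.length)))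
      (strCells b) (machine.step φ c) := by
  refine h.plain (m := .right) (by simp) (by simp) ?_ (fun j => ?_) (zeroCells_scan b m p)
    (fun j => ?_) (i := inCells a n p) (q := strCells b p)
  · simp only [trans]
    rw [if_pos (by simp; omega)]
  all_goals split_ifs with hj <;> simp [hj]

theorem Describes.scan_end
    (h : Describes .scan p (inCells a n) O (strCells b) c) (hn : n ≤ a.length)
    (hp : p = max a.length b.length) :
    Describes .fill p (inCells a n) O (strCells b) (machine.step φ c) := by
  refine h.plain (m := .stay) (by simp) (by simp) ?_ (fun j => ?_) (fun j => ?_) (fun j => ?_)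
    (i := inCells a n p) (o := O p) (q := strCells b p)
  · simp only [trans]
    rw [if_neg (by simp; omega)]
  all_goals split_ifs with hj <;> simp [hj]

/-- The cells of the oracle tape while the next query is written from right to left. -/
def fillCells (b : Str) (n p j : ℕ) : Symbol Unit := if j < p then strCells b j else zeroCells n j

/-- Writing at `p` moves the boundary between the old answer and the new query from `p + 1` down to
`p`. -/
theorem fillCells_write (a b : Str) (n p j : ℕ) :
    fillCells b n p j =
      if j = p then unary (inCells a n p) else fillCells b n (p + 1) j := by
  rw [unary_inCells]
  simp only [fillCells]
  split_ifs with h₁ h₂ h₃ h₄ h₅ <;> first | rfl | omega | simp [*]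

theorem Describes.fill_left
    (h : Describes .fill (p + 1) (inCells a n) O (fillCells b n (p + 2)) c) :
    Describes .fill p (inCells a n) O (fillCells b n (p + 1)) (machine.step φ c) := by
  refine h.plain (m := .left) (by simp) (by simp) ?_ (fun j => ?_) (fun j => ?_)
    (fillCells_write a b n (p + 1))
    (i := inCells a n (p + 1)) (o := O (p + 1))
  · simp only [trans]
    rw [if_neg (by simp)]
  all_goals split_ifs with hj <;> simp [hj]

theorem Describes.fill_end
    (h : Describes .fill 0 (inCells a n) O (fillCells b n 1) c) :
    Describes .query 0 (inCells a n) O (zeroCells n) (machine.step φ c) := by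
  refine h.plain (m := .stay) (by simp) (by simp) ?_ (fun j => ?_) (fun j => ?_)
    (fillCells_write a b n 0)
    (i := inCells a n 0) (o := O 0)
  · simp only [trans]
    rw [if_pos (by simp)]
  all_goals split_ifs with hj <;> simp [hj]

/-- Used for sweeps to the right, with `P` indexed by the head position. -/
theorem iterate_step {P : ℕ → machine.Cfg → Prop} {lo hi : ℕ} (hle : lo ≤ hi)
    (hP : ∀ p c, lo ≤ p → p < hi → P p c → P (p + 1) (machine.step φ c)) (h : P lo c) :
    P hi ((machine.step φ)^[hi - lo] c) := by
  induction hi, hle using Nat.le_induction with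
  | base => simpa using h
  | succ k hk ih =>
    rw [Nat.succ_sub hk, Function.iterate_succ_apply']
    exact hP _ _ hk k.lt_succ_self (ih fun p c h₁ h₂ => hP p c h₁ (h₂.trans k.lt_succ_self))

theorem Describes.fill
    (h : Describes .fill p (inCells a n) O (fillCells b n (p + 1)) c) :
    Describes .query 0 (inCells a n) O (zeroCells n) ((machine.step φ)^[p + 1] c) := by
  induction p generalizing c with
  | zero => exact h.fill_end
  | succ p ih => exact ih h.fill_left

/-- The number of steps from one query to the next. -/
def roundSteps (a b : Str) : ℕ := 2 * max a.length b.length + 2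

theorem Describes.round
    (h : Describes .resume 0 (inCells a n) (zeroCells m) (strCells b) c) (hn : n < a.length) :
    Describes .query 0 (inCells a (n + 1)) (zeroCells (max m b.length)) (zeroCells (n + 1))
      ((machine.step φ)^[roundSteps a b] c) := by
  set e := max a.length b.length with he
  have h₁ := iterate_step (φ := φ) (P := fun p => Describes .resume p (inCells a n)
      (zeroCells (max m (min p b.length))) (strCells b)) (Nat.zero_le n)
    (fun p c _ hp h => h.resume_skip (.inl hp)) (by simpa using h)
  have h₂ := iterate_step (φ := φ) (P := fun p => Describes .scan p (inCells a (n + 1))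
      (zeroCells (max m (min p b.length))) (strCells b)) (show n + 1 ≤ e by omega)
    (fun p c _ hp h => h.scan_skip hp) (h₁.resume_mark (φ := φ) hn)
  rw [show min e b.length = b.length by omega] at h₂
  have h₃ := h₂.scan_end (φ := φ) hn he
  -- Beyond cell `e` both the answer and the query `0 ^ (n + 1)` are blank, so the leftward sweep
  -- can start with nothing yet written.
  have hb : strCells b = fillCells b (n + 1) (e + 1) := by
    funext j
    simp only [fillCells]
    split_ifs with hj
    · rfl
    · rw [strCells_of_length_le (by omega), zeroCells, if_neg (by omega)]
  rw [hb] at h₃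
  have h₄ := h₃.fill (φ := φ)
  simp only [← Function.iterate_succ_apply' (machine.step φ), ← Function.iterate_add_apply] at h₄
  -- The steps are `n` skips, one marking, `e - (n + 1)` scans, one turn and `e + 1` fills: `2 * e +
  -- 2` altogether.
  convert h₄ using 2
  simp only [roundSteps]
  omega

theorem Describes.last_round
    (h : Describes .resume 0 (inCells a a.length) (zeroCells m) (strCells b) c) :
    Describes .halt (max a.length b.length) (inCells a a.length) (zeroCells (max m b.length))
      (strCells b) ((machine.step φ)^[max a.length b.length + 1] c) := by
  have h₁ := iterate_step (φ := φ) (P := fun p => Describes .resume p (inCells a a.length)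
      (zeroCells (max m (min p b.length))) (strCells b)) (Nat.zero_le (max a.length b.length))
    (fun p c _ hp h => h.resume_skip (by omega)) (by simpa using h)
  rw [show min (max a.length b.length) b.length = b.length by omega] at h₁
  have h₂ := h₁.resume_halt (φ := φ) rfl
  rwa [← Function.iterate_succ_apply' (machine.step φ)] at h₂

theorem run_eq_iterate (φ : Baire) (a : Str) (t : ℕ) :
    machine.run φ a t = (machine.step φ)^[t] (machine.init a) := by
  induction t with
  | zero => rfl
  | succ t ih => rw [Function.iterate_succ_apply', ← ih]; rfl

theorem nth_act_read {A : Type} (t : Tape A) (m : Move) (j : ℕ) :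
    (t.act t.read m).cells.nth j = t.cells.nth j := by
  rw [Tape.nth_act]
  split_ifs with h
  · rw [h]; rfl
  · rfl

theorem describes_start (φ : Baire) (a : Str) :
    Describes .query 0 (inCells a 0) (zeroCells 0) (zeroCells 0)
      (machine.step φ (machine.init a)) := by
  have hstep : machine.step φ (machine.init a) = machine.plainStep (machine.init a) := by
    rw [OracleTM.step, if_neg Control.noConfusion, if_neg Control.noConfusion]
  rw [hstep]
  refine ⟨rfl, fun i => by cases i <;> rfl, fun j => ?_, fun j => ?_, fun j => ?_, fun j => ?_⟩
  · change (((machine.init a).tape .input).act ((machine.init a).tape .input).read .stay).cells.nth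
      j = _
    rw [nth_act_read]
    simp [Tape.nth_ofStr, inCells, strCells, OracleTM.init]
  · change (((machine.init a).tape .output).act
      ((machine.init a).tape .output).read .stay).cells.nth j = _
    rw [nth_act_read]
    simp [Tape.nth_ofStr, zeroCells, OracleTM.init]
  · change (((machine.init a).tape .oracle).act
      ((machine.init a).tape .oracle).read .stay).cells.nth j = _
    rw [nth_act_read]
    simp [Tape.nth_ofStr, zeroCells, OracleTM.init]
  · change ((Tape.ofStr [] 0 : Tape Unit).act mark .stay).cells.nth j = _
    rw [Tape.nth_act, Tape.nth_ofStr]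
    simp [workCells, Tape.ofStr]

/-! ### Correctness and running time of the whole computation. -/

/-- The maximal length of the answers to the queries `0 ^ i` with `i < n`. -/
def maxAnswer (φ : Baire) (n : ℕ) : ℕ :=
  (Finset.range n).sup fun i => (φ (List.replicate i false)).length

theorem maxAnswer_succ (φ : Baire) (n : ℕ) :
    maxAnswer φ (n + 1) = max (maxAnswer φ n) (φ (List.replicate n false)).length := by
  rw [maxAnswer, Finset.range_add_one, Finset.sup_insert, sup_comm]
  rfl

/-- The initial `1` is the step that marks the memory tape. A round is one query step followed by
`roundSteps`, and the maximum there is bounded by the sum `|a| + |φ|(|a|)`. -/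
theorem exists_describes_query (φ : Baire) (a : Str) (n : ℕ) (hn : n ≤ a.length) :
    ∃ t ≤ 1 + n * (2 * (a.length + size φ a.length) + 3),
      Describes .query 0 (inCells a n) (zeroCells (maxAnswer φ n)) (zeroCells n)
        (machine.run φ a t) := by
  induction n with
  | zero => exact ⟨1, by omega, describes_start φ a⟩
  | succ n ih =>
    obtain ⟨t, ht, h⟩ := ih (by omega)
    have hsize : (φ (List.replicate n false)).length ≤ size φ a.length :=
      length_le_size φ (by simp; omega)
    refine ⟨roundSteps a (φ (List.replicate n false)) + (t + 1), ?_, ?_⟩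
    · rw [roundSteps, add_one_mul]
      generalize hK : 2 * (a.length + size φ a.length) + 3 = K at *
      omega
    · have := (h.ask (φ := φ)).round (φ := φ) hn
      rw [maxAnswer_succ, run_eq_iterate, Function.iterate_add_apply,
        Function.iterate_succ_apply' _ t, ← run_eq_iterate]
      exact this

theorem exists_describes_halt (φ : Baire) (a : Str) :
    ∃ t ≤ 3 + (a.length + 1) * (2 * (a.length + size φ a.length) + 3),
      ∃ p I Q, Describes .halt p I (zeroCells (maxAnswer φ (a.length + 1))) Q
        (machine.run φ a t) := by
  obtain ⟨t, ht, h⟩ := exists_describes_query φ a a.length le_rfl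
  have hsize : (φ (List.replicate a.length false)).length ≤ size φ a.length :=
    length_le_size φ (by simp)
  refine ⟨max a.length (φ (List.replicate a.length false)).length + 1 + (t + 1), ?_, ?_⟩
  · rw [add_one_mul]
    generalize hK : 2 * (a.length + size φ a.length) + 3 = K at *
    omega
  · have := (h.ask (φ := φ)).last_round (φ := φ)
    rw [maxAnswer_succ, run_eq_iterate, Function.iterate_add_apply,
      Function.iterate_succ_apply' _ t, ← run_eq_iterate]
    exact ⟨_, _, _, this⟩

theorem computes_maxLength : machine.Computes maxLength := by
  intro φ a
  obtain ⟨t, -, p, I, Q, h⟩ := exists_describes_halt φ a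
  have hF : maxLength φ a = List.replicate (maxAnswer φ (a.length + 1)) false := rfl
  rw [hF]
  refine ⟨t, h.state, Tape.content_eq_of_nth (fun i hi => ?_) ?_⟩
  · rw [h.output, zeroCells, if_pos (by simpa using hi), List.getElem_replicate]
  · rw [h.output, zeroCells, if_neg (by simp)]
    rfl

end MaxLengthMachine

open MaxLengthMachine in
theorem maxLength_mem_polyTime : maxLength ∈ PolyTime := by
  have hn : SecondOrderPoly fun _ n => n := by
    simpa using SecondOrderPoly.poly Polynomial.X
  have hc (k : ℕ) : SecondOrderPoly fun _ _ => k := by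
    simpa using SecondOrderPoly.poly (Polynomial.C k)
  refine ⟨machine, computes_maxLength, _,
    (hc 3).add ((hn.add (hc 1)).mul (((hc 2).mul (hn.add hn.app)).add (hc 3))), fun φ a => ?_⟩
  obtain ⟨t, ht, p, I, Q, h⟩ := exists_describes_halt φ a
  refine (OracleTM.time_le_of_haltedAt (show machine.HaltedAt φ a t from h.state)).trans ?_
  exact_mod_cast ht

end OracleComplexity

theorem mainTheorem4 :
    OracleComplexity.maxLength ∈ OracleComplexity.PolyTime ∧
    OracleComplexity.maxLength ∉ OracleComplexity.FLR ∧
    OracleComplexity.maxLength ∉ OracleComplexity.StrongPolyTime ∧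
    OracleComplexity.StrongPolyTime ⊂ OracleComplexity.PolyTime := by
  open OracleComplexity in
  have hSP : maxLength ∉ StrongPolyTime :=
    fun h => maxLength_notMem_FLR (strongPolyTime_subset_FLR h)
  exact ⟨maxLength_mem_polyTime, maxLength_notMem_FLR, hSP,
    (Set.ssubset_iff_of_subset strongPolyTime_subset_polyTime).2
      ⟨_, maxLength_mem_polyTime, hSP⟩⟩
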